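/- A behavior is a table $P(a,b|x,y)$ with $a,b,x,y\in\{0,1\}$. It is called quantum if $P(a,b|x,y)=\mathrm{Tr}[(A_{a|x}\otimes B_{b|y})\rho]$ for some density operator $\rho$ on a tensor product $H_A\otimes H_B$ of complex Hilbert spaces and some two-outcome measurements (POVMs) $\{A_{a|x}\}_a$ on $H_A$ and $\{B_{b|y}\}_b$ on $H_B$; let $P(a|x)=\sum_b P(a,b|x,y)$ denote Alice's marginal (for a quantum behavior it does not depend on $y$). Fix Eve's target input $x^*\in\{0,1\}$ and a bias $r\in[1/2,1)$. Let $\pi_{xy}=\pi_x/2$ with $\pi_{x^*}=r$ and $\pi_{1-x^*}=1-r$ (Alice's input is biased towards $x^*$, Bob's input is independent and uniform). The average score of a behavior in the corresponding biased CHSH game is $$V_\pi[P]=4\sum_{a,b,x,y}\pi_{xy}\,P(a,b|x,y)\,(-1)^{a+b+xy}.$$ For $S\in\mathbb{R}$, let $G_{x^*}(S)$ be the maximum of Eve's guessing probability $$\sum_\lambda q_\lambda\max_{a}P_\lambda(a|x^*)$$ over all discrete probability distributions $(q_\lambda)$ and all families of quantum behaviors $(P_\lambda)$ such that $V_\pi\big[\sum_\lambda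 q_\lambda P_\lambda\big]=S$. Then for every $S\in\big[4r,\,4\sqrt{r^2+(1-r)^2}\big]$ the maximum is attained and $$G_{x^*}(S)=\frac12\left\{1+\sqrt{1-\frac{1}{(1-r)^2}\left[\left(\frac S4\right)^2-r^2\right]}\right\}.$$ For $r=1/2$ the score $V_\pi[P]$ is the standard CHSH value $S[P]=\sum_{a,b,x,y}(-1)^{a+b+xy}P(a,b|x,y)$, and the formula reduces to the standard one, $\frac12\big[1+\sqrt{2-(S/2)^2}\big]$. -/

import Mathlib

open scoped TensorProduct InnerProductSpace

noncomputable section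

namespace BiasedCHSH

/-- The completed (Hilbert-space) tensor product of two Hilbert spaces. -/
abbrev HTensor (H K : Type) [NormedAddCommGroup H] [InnerProductSpace ℂ H]
    [NormedAddCommGroup K] [InnerProductSpace ℂ K] : Type :=
  UniformSpace.Completion (H ⊗[ℂ] K)

/-- The bounded operator `A ⊗ B` on the Hilbert-space tensor product. -/
def opTensor {H K : Type} [NormedAddCommGroup H] [InnerProductSpace ℂ H]
    [NormedAddCommGroup K] [InnerProductSpace ℂ K]
    (A : H →L[ℂ] H) (B : K →L[ℂ] K) : HTensor H K →L[ℂ] HTensor H K :=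
  (TensorProduct.mapL A B).completion

/-- `T` has trace `t`: in every Hilbert basis the diagonal matrix elements of `T` sum
(unconditionally) to `t`. -/
def HasTrace {H : Type} [NormedAddCommGroup H] [InnerProductSpace ℂ H]
    (T : H →L[ℂ] H) (t : ℂ) : Prop :=
  ∀ (ι : Type) (e : HilbertBasis ι ℂ H), HasSum (fun i => ⟪e i, T (e i)⟫_ℂ) t

/-- A density operator: positive with trace one. -/
def IsDensity {H : Type} [NormedAddCommGroup H] [InnerProductSpace ℂ H]
    (ρ : H →L[ℂ] H) : Prop :=
  ρ.IsPositive ∧ HasTrace ρ 1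

/-- A two-outcome measurement (POVM). -/
def IsPOVM {H : Type} [NormedAddCommGroup H] [InnerProductSpace ℂ H]
    (M : Fin 2 → (H →L[ℂ] H)) : Prop :=
  (∀ a, (M a).IsPositive) ∧ ∑ a, M a = 1

/-- A table `P a b x y` standing for the probabilities `P(a,b|x,y)`. -/
abbrev Behavior : Type := Fin 2 → Fin 2 → Fin 2 → Fin 2 → ℝ

/-- `P` is quantum: `P(a,b|x,y) = Tr[(A_{a|x} ⊗ B_{b|y}) ρ]` for local measurements and a
bipartite state on Hilbert spaces of arbitrary (possibly infinite) dimension. -/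
def IsQuantum (P : Behavior) : Prop :=
  ∃ (H : Type) (_ : NormedAddCommGroup H) (_ : InnerProductSpace ℂ H) (_ : CompleteSpace H)
    (K : Type) (_ : NormedAddCommGroup K) (_ : InnerProductSpace ℂ K) (_ : CompleteSpace K)
    (A : Fin 2 → Fin 2 → (H →L[ℂ] H)) (B : Fin 2 → Fin 2 → (K →L[ℂ] K))
    (ρ : HTensor H K →L[ℂ] HTensor H K),
    (∀ x, IsPOVM (A x)) ∧ (∀ y, IsPOVM (B y)) ∧ IsDensity ρ ∧
    ∀ a b x y, HasTrace (opTensor (A x a) (B y b) ∘L ρ) (P a b x y : ℂ)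

/-- Alice's marginal `P(a|x)`. Quantum behaviors are no-signaling, so Bob's input, set to `0`
here, is immaterial. -/
def marginal (P : Behavior) (a x : Fin 2) : ℝ := ∑ b, P a b x 0

/-- The average score of `P` in the CHSH game with input distribution `π`, a win
(`a + b = x y` mod 2) scoring `4` and a loss `-4`. -/
def score (π : Fin 2 → Fin 2 → ℝ) (P : Behavior) : ℝ :=
  4 * ∑ a : Fin 2, ∑ b : Fin 2, ∑ x : Fin 2, ∑ y : Fin 2,
    π x y * P a b x y * (-1 : ℝ) ^ (a.val + b.val + x.val * y.val)

/-- The CHSH functional. -/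
def chsh (P : Behavior) : ℝ :=
  ∑ a : Fin 2, ∑ b : Fin 2, ∑ x : Fin 2, ∑ y : Fin 2,
    (-1 : ℝ) ^ (a.val + b.val + x.val * y.val) * P a b x y

/-- Alice's input equals `xs` with probability `r`; Bob's input is independent and uniform. -/
def biasedInputs (r : ℝ) (xs : Fin 2) (x _y : Fin 2) : ℝ :=
  (if x = xs then r else 1 - r) * (1 / 2)

/-- The average behavior `∑_l q_l P_l`. -/
def average {Λ : Type} (q : Λ → ℝ) (P : Λ → Behavior) : Behavior :=
  fun a b x y => ∑' l, q l * P l a b x y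

/-- All values of Eve's guessing probability of Alice's output for input `xs` compatible with
the value `S` of the functional `V`: a hidden variable `l` has distribution `q`, each `P l` is
quantum, the average behavior satisfies `V = S`, and Eve, knowing `l`, guesses the most likely
output. -/
def guessingValues (V : Behavior → ℝ) (xs : Fin 2) (S : ℝ) : Set ℝ :=
  {g | ∃ (Λ : Type) (q : Λ → ℝ) (P : Λ → Behavior),
    (∀ l, 0 ≤ q l) ∧ HasSum q 1 ∧ (∀ l, IsQuantum (P l)) ∧ V (average q P) = S ∧
    g = ∑' l, q l * max (marginal (P l) 0 xs) (marginal (P l) 1 xs)}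

/-- The closed formula for the guessing probability in the biased game. -/
def guessFormula (r S : ℝ) : ℝ :=
  1 / 2 * (1 + √(1 - 1 / (1 - r) ^ 2 * ((S / 4) ^ 2 - r ^ 2)))

end BiasedCHSH

end

/-!
On one Hilbert space carrying both commuting families of measurements, a density operator `ρ`
acts as the family of vectors `√ρ e_j`, for a Hilbert basis `e_j`. Let `A` be Alice's observable
for the guessed input and put `e = √((1 + A) / 2)` and `f = √((1 - A) / 2)`, so that
`e² + f² = 1` and `A = e² - f²`. Splitting a unit vector as `ψ = e (e ψ) + f (f ψ)` and applying
the Cauchy–Schwarz inequality to the two parts gives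
`(V_π / 4)² + ((1 - r) ⟨A⟩)² ≤ r² + (1 - r)²`.
This says that a point of the plane lies in a disc, a convex condition, so it survives the
average over the `√ρ e_j` and then over the hidden variable, where `⟨A⟩` may be replaced by
`|⟨A⟩|`, the advantage of Eve's best guess. The bound is attained without hidden variable, by the
state `cos χ |00⟩ + sin χ |11⟩` with the guessed measurement in the Schmidt basis.
-/

noncomputable section

namespace BiasedCHSH

open InnerProductSpace (rankOne)

section OpTensor

variable {H K : Type} [NormedAddCommGroup H] [InnerProductSpace ℂ H]
  [NormedAddCommGroup K] [InnerProductSpace ℂ K]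

theorem opTensor_coe (A : H →L[ℂ] H) (B : K →L[ℂ] K) (x : H ⊗[ℂ] K) :
    opTensor A B (x : HTensor H K) = (TensorProduct.mapL A B x : H ⊗[ℂ] K) :=
  ContinuousLinearMap.completion_apply_coe _ _

theorem HTensor.clm_ext {S T : HTensor H K →L[ℂ] HTensor H K}
    (h : ∀ x : H ⊗[ℂ] K, S (x : HTensor H K) = T (x : HTensor H K)) : S = T := by
  ext x
  induction x using UniformSpace.Completion.induction_on with
  | hp => exact isClosed_eq S.continuous T.continuous
  | ih x => exact h x

theorem opTensor_mul (A A' : H →L[ℂ] H) (B B' : K →L[ℂ] K) :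
    opTensor (A * A') (B * B') = opTensor A B * opTensor A' B' :=
  HTensor.clm_ext fun x => by
    simp only [mul_apply_eq_comp, opTensor_coe, TensorProduct.mapL_mul]

theorem opTensor_one : opTensor (1 : H →L[ℂ] H) (1 : K →L[ℂ] K) = 1 :=
  HTensor.clm_ext fun x => by
    rw [opTensor_coe, ContinuousLinearMap.one_def, ContinuousLinearMap.one_def,
      TensorProduct.mapL_id_id, ContinuousLinearMap.id_apply, one_apply_eq_self]

theorem opTensor_add_left (A A' : H →L[ℂ] H) (B : K →L[ℂ] K) :
    opTensor (A + A') B = opTensor A B + opTensor A' B :=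
  HTensor.clm_ext fun x => by
    simp only [add_apply, opTensor_coe, TensorProduct.mapL_add_left,
      UniformSpace.Completion.coe_add]

theorem opTensor_add_right (A : H →L[ℂ] H) (B B' : K →L[ℂ] K) :
    opTensor A (B + B') = opTensor A B + opTensor A B' :=
  HTensor.clm_ext fun x => by
    simp only [add_apply, opTensor_coe, TensorProduct.mapL_add_right,
      UniformSpace.Completion.coe_add]

theorem commute_opTensor_one_one_opTensor (A : H →L[ℂ] H) (B : K →L[ℂ] K) :
    Commute (opTensor A 1) (opTensor 1 B) := by
  rw [Commute, SemiconjBy, ← opTensor_mul, ← opTensor_mul, one_mul, mul_one, mul_one, one_mul]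

variable [CompleteSpace H] [CompleteSpace K]

theorem inner_mapL_left (A : H →L[ℂ] H) (B : K →L[ℂ] K) (x y : H ⊗[ℂ] K) :
    ⟪TensorProduct.mapL A B x, y⟫_ℂ = ⟪x, TensorProduct.mapL (star A) (star B) y⟫_ℂ := by
  induction x with
  | zero => simp only [map_zero, inner_zero_left]
  | add x x' hx hx' => rw [map_add, inner_add_left, inner_add_left, hx, hx']
  | tmul x x' =>
    induction y with
    | zero => simp only [map_zero, inner_zero_right]
    | add y y' hy hy' => rw [map_add, inner_add_right, inner_add_right, hy, hy']
    | tmul y y' =>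
      simp only [TensorProduct.mapL_tmul, TensorProduct.inner_tmul,
        ContinuousLinearMap.star_eq_adjoint, ContinuousLinearMap.adjoint_inner_right]

theorem star_opTensor (A : H →L[ℂ] H) (B : K →L[ℂ] K) :
    star (opTensor A B) = opTensor (star A) (star B) := by
  refine ((ContinuousLinearMap.eq_adjoint_iff _ _).2 fun x y => ?_).symm
  induction x, y using UniformSpace.Completion.induction_on₂ with
  | hp => exact isClosed_eq (by fun_prop) (by fun_prop)
  | ih x y =>
    simpa only [opTensor_coe, UniformSpace.Completion.inner_coe, star_star] using
      inner_mapL_left (star A) (star B) x y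

theorem opTensor_nonneg {A : H →L[ℂ] H} {B : K →L[ℂ] K} (hA : 0 ≤ A) (hB : 0 ≤ B) :
    0 ≤ opTensor A B := by
  rw [← CFC.sqrt_mul_sqrt_self A hA, ← CFC.sqrt_mul_sqrt_self B hB, opTensor_mul]
  exact IsSelfAdjoint.mul_self_nonneg (by
    rw [IsSelfAdjoint, star_opTensor, (CFC.sqrt_nonneg A).isSelfAdjoint.star_eq,
      (CFC.sqrt_nonneg B).isSelfAdjoint.star_eq])

end OpTensor

section Trace

variable {ι : Type*} {H : Type*} [NormedAddCommGroup H] [InnerProductSpace ℂ H]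

theorem hasSum_norm_inner_sq (e : HilbertBasis ι ℂ H) (x : H) :
    HasSum (fun i => ‖⟪e i, x⟫_ℂ‖ ^ 2) (‖x‖ ^ 2) := by
  have h := (e.hasSum_inner_mul_inner x x).mapL Complex.reCLM
  convert h using 1
  · ext i
    rw [← inner_conj_symm x (e i), Complex.conj_mul']
    simp [← Complex.ofReal_pow]
  · simp [inner_self_eq_norm_sq_to_K, ← Complex.ofReal_pow]

theorem summable_norm_inner_sq_of_summable_norm_sq (e : HilbertBasis ι ℂ H) {v : ι → H}
    (hv : Summable fun j => ‖v j‖ ^ 2) :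
    Summable fun p : ι × ι => ‖⟪e p.2, v p.1⟫_ℂ‖ ^ 2 := by
  refine (summable_prod_of_nonneg fun _ => sq_nonneg _).2
    ⟨fun j => (hasSum_norm_inner_sq e (v j)).summable, ?_⟩
  simpa only [(hasSum_norm_inner_sq e _).tsum_eq] using hv

theorem summable_inner_mul_inner (e : HilbertBasis ι ℂ H) {u v : ι → H}
    (hu : Summable fun j => ‖u j‖ ^ 2) (hv : Summable fun j => ‖v j‖ ^ 2) :
    Summable fun p : ι × ι => ⟪u p.1, e p.2⟫_ℂ * ⟪e p.2, v p.1⟫_ℂ := by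
  refine Summable.of_norm_bounded ((summable_norm_inner_sq_of_summable_norm_sq e hu).add
    (summable_norm_inner_sq_of_summable_norm_sq e hv)) fun p => ?_
  rw [norm_mul, norm_inner_symm]
  have hpos := mul_nonneg (norm_nonneg ⟪e p.2, u p.1⟫_ℂ) (norm_nonneg ⟪e p.2, v p.1⟫_ℂ)
  linarith [two_mul_le_add_sq ‖⟪e p.2, u p.1⟫_ℂ‖ ‖⟪e p.2, v p.1⟫_ℂ‖]

variable [CompleteSpace H]

/-- Cyclicity of the trace for a Hilbert–Schmidt operator `Q`. -/
theorem hasSum_inner_apply_of_hasSum_inner_apply_adjoint (e : HilbertBasis ι ℂ H)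
    (T Q : H →L[ℂ] H) (hQ : Summable fun j => ‖Q (e j)‖ ^ 2) {t : ℂ}
    (ht : HasSum (fun i => ⟪e i, T (Q (Q.adjoint (e i)))⟫_ℂ) t) :
    HasSum (fun j => ⟪Q (e j), T (Q (e j))⟫_ℂ) t := by
  have hTQ : Summable fun j => ‖T (Q (e j))‖ ^ 2 :=
    (hQ.mul_left (‖T‖ ^ 2)).of_nonneg_of_le (fun _ => sq_nonneg _) fun j => by
      rw [← mul_pow]
      gcongr
      exact T.le_opNorm _
  have hF := (summable_inner_mul_inner e hQ hTQ).hasSum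
  have hcol (i : ι) : HasSum (fun j => ⟪Q (e j), e i⟫_ℂ * ⟪e i, T (Q (e j))⟫_ℂ)
      ⟪e i, T (Q (Q.adjoint (e i)))⟫_ℂ := by
    have h := e.hasSum_inner_mul_inner (Q.adjoint (T.adjoint (e i))) (Q.adjoint (e i))
    rw [ContinuousLinearMap.adjoint_inner_left, ContinuousLinearMap.adjoint_inner_left] at h
    simpa only [ContinuousLinearMap.adjoint_inner_left, ContinuousLinearMap.adjoint_inner_right,
      mul_comm] using h
  rw [ht.unique (((Equiv.prodComm ι ι).hasSum_iff.2 hF).prod_fiberwise hcol)]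
  exact hF.prod_fiberwise fun j => e.hasSum_inner_mul_inner (Q (e j)) (T (Q (e j)))

end Trace

section RankOne

variable {H : Type} [NormedAddCommGroup H] [InnerProductSpace ℂ H]

theorem hasTrace_comp_rankOne (T : H →L[ℂ] H) (φ ψ : H) :
    HasTrace (T ∘L rankOne ℂ φ ψ) ⟪ψ, T φ⟫_ℂ := by
  intro ι e
  convert! e.hasSum_inner_mul_inner ψ (T φ) using 2
  simp only [ContinuousLinearMap.comp_apply, InnerProductSpace.rankOne_apply, map_smul,
    inner_smul_right]

theorem isDensity_rankOne {ψ : H} (hψ : ‖ψ‖ = 1) : IsDensity (rankOne ℂ ψ ψ) := by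
  refine ⟨InnerProductSpace.isPositive_rankOne_self ψ, ?_⟩
  have h := hasTrace_comp_rankOne (ContinuousLinearMap.id ℂ H) ψ ψ
  rwa [ContinuousLinearMap.id_comp, ContinuousLinearMap.id_apply, inner_self_eq_norm_sq_to_K,
    hψ, RCLike.ofReal_one, one_pow] at h

/-- The vectors are the images of a Hilbert basis under the square root of the density operator,
which avoids diagonalizing it. -/
theorem IsDensity.exists_hasSum_inner [CompleteSpace H] {ρ : H →L[ℂ] H} (hρ : IsDensity ρ) :
    ∃ (ι : Type) (ψ : ι → H), HasSum (fun j => ‖ψ j‖ ^ 2) 1 ∧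
      ∀ {T : H →L[ℂ] H} {t : ℂ}, HasTrace (T ∘L ρ) t →
        HasSum (fun j => ⟪ψ j, T (ψ j)⟫_ℂ) t := by
  obtain ⟨ι, e, -⟩ := exists_hilbertBasis ℂ H
  let Q := CFC.sqrt ρ
  have hQ : Q.adjoint = Q := (CFC.sqrt_nonneg ρ).isSelfAdjoint
  have hρQ (φ : H) : ρ φ = Q (Q.adjoint φ) := by
    rw [hQ, ← mul_apply_eq_comp, CFC.sqrt_mul_sqrt_self ρ
      ((ContinuousLinearMap.nonneg_iff_isPositive ρ).2 hρ.1)]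
  have hnorm : HasSum (fun j => ‖Q (e j)‖ ^ 2) 1 := by
    have hre := (hρ.2 ι e).mapL Complex.reCLM
    rw [Complex.reCLM_apply, Complex.one_re] at hre
    convert hre using 2 with j
    rw [hρQ, ← ContinuousLinearMap.adjoint_inner_left, hQ, Complex.reCLM_apply,
      ← inner_self_eq_norm_sq (𝕜 := ℂ)]
    rfl
  refine ⟨ι, fun j => Q (e j), hnorm, fun {T t} hT => ?_⟩
  refine hasSum_inner_apply_of_hasSum_inner_apply_adjoint e T Q hnorm.summable ?_
  simpa only [ContinuousLinearMap.comp_apply, hρQ] using hT ι e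

end RankOne

section CommutingModel

variable {X : Type} [NormedAddCommGroup X] [InnerProductSpace ℂ X]

theorem IsPOVM.nonneg {M : Fin 2 → (X →L[ℂ] X)} (hM : IsPOVM M) (a : Fin 2) : 0 ≤ M a :=
  (ContinuousLinearMap.nonneg_iff_isPositive _).2 (hM.1 a)

/-- The commuting-operator model of a Bell experiment: all measurements act on one space, and
Alice's measurement operators `M x a` commute with Bob's `N y b`. -/
structure CommutingMeasurements (M N : Fin 2 → Fin 2 → (X →L[ℂ] X)) : Prop where
  left : ∀ x, IsPOVM (M x)
  right : ∀ y, IsPOVM (N y)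
  commute : ∀ x a y b, Commute (M x a) (N y b)

/-- The table of expectations of `M x a * N y b` in the vector `ψ`, which need not be
normalized. -/
def vectorBehavior (M N : Fin 2 → Fin 2 → (X →L[ℂ] X)) (ψ : X) : Behavior :=
  fun a b x y => (⟪ψ, (M x a * N y b) ψ⟫_ℂ).re

theorem commutingMeasurements_opTensor {H K : Type} [NormedAddCommGroup H]
    [InnerProductSpace ℂ H] [CompleteSpace H] [NormedAddCommGroup K] [InnerProductSpace ℂ K]
    [CompleteSpace K] {A : Fin 2 → Fin 2 → (H →L[ℂ] H)} {B : Fin 2 → Fin 2 → (K →L[ℂ] K)}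
    (hA : ∀ x, IsPOVM (A x)) (hB : ∀ y, IsPOVM (B y)) :
    CommutingMeasurements (fun x a => opTensor (A x a) (1 : K →L[ℂ] K))
      (fun y b => opTensor (1 : H →L[ℂ] H) (B y b)) where
  left x := by
    refine ⟨fun a => ?_, ?_⟩
    · exact (ContinuousLinearMap.nonneg_iff_isPositive _).1
        (opTensor_nonneg ((hA x).nonneg a) zero_le_one)
    · rw [Fin.sum_univ_two, ← opTensor_add_left, ← Fin.sum_univ_two, (hA x).2, opTensor_one]
  right y := by
    refine ⟨fun b => ?_, ?_⟩
    · exact (ContinuousLinearMap.nonneg_iff_isPositive _).1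
        (opTensor_nonneg zero_le_one ((hB y).nonneg b))
    · rw [Fin.sum_univ_two, ← opTensor_add_right, ← Fin.sum_univ_two, (hB y).2, opTensor_one]
  commute x a y b := commute_opTensor_one_one_opTensor (A x a) (B y b)

theorem IsQuantum.exists_commutingMeasurements {P : Behavior} (hP : IsQuantum P) :
    ∃ (X : Type) (_ : NormedAddCommGroup X) (_ : InnerProductSpace ℂ X) (_ : CompleteSpace X)
      (M N : Fin 2 → Fin 2 → (X →L[ℂ] X)) (ι : Type) (ψ : ι → X),
      CommutingMeasurements M N ∧ HasSum (fun j => ‖ψ j‖ ^ 2) 1 ∧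
      ∀ a b x y, HasSum (fun j => vectorBehavior M N (ψ j) a b x y) (P a b x y) := by
  obtain ⟨H, _, _, _, K, _, _, _, A, B, ρ, hA, hB, hρ, hPρ⟩ := hP
  obtain ⟨ι, ψ, hψ_norm, hψ⟩ := hρ.exists_hasSum_inner
  refine ⟨HTensor H K, inferInstance, inferInstance, inferInstance,
    fun x a => opTensor (A x a) 1, fun y b => opTensor 1 (B y b), ι, ψ,
    commutingMeasurements_opTensor hA hB, hψ_norm, fun a b x y => ?_⟩
  simpa only [vectorBehavior, ← opTensor_mul, mul_one, one_mul] using!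
    (hψ (hPρ a b x y)).mapL Complex.reCLM

end CommutingModel

section OperatorBound

variable {X : Type*} [NormedAddCommGroup X] [InnerProductSpace ℂ X]

theorem re_inner_add_apply_sub {x : X →L[ℂ] X} (hx : (x : X →ₗ[ℂ] X).IsSymmetric) (u v : X) :
    (⟪u + v, x (u - v)⟫_ℂ).re = (⟪u, x u⟫_ℂ).re - (⟪v, x v⟫_ℂ).re := by
  have hswap : (⟪v, x u⟫_ℂ).re = (⟪u, x v⟫_ℂ).re := by
    rw [← Complex.conj_re, inner_conj_symm]
    exact congrArg Complex.re (hx u v)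
  simp only [map_sub, inner_add_left, inner_sub_right, Complex.add_re, Complex.sub_re, hswap]
  ring

theorem abs_re_inner_le_norm_mul_norm (φ η : X) : |(⟪φ, η⟫_ℂ).re| ≤ ‖φ‖ * ‖η‖ :=
  (Complex.abs_re_le_norm _).trans (norm_inner_le_norm φ η)

theorem norm_smul_add_smul_sq (r s : ℝ) (u v : X) :
    ‖(r : ℂ) • u + (s : ℂ) • v‖ ^ 2 =
      r ^ 2 * ‖u‖ ^ 2 + 2 * r * s * (⟪u, v⟫_ℂ).re + s ^ 2 * ‖v‖ ^ 2 := by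
  rw [norm_add_sq (𝕜 := ℂ), norm_smul, norm_smul, inner_smul_left, inner_smul_right, mul_pow,
    mul_pow, Complex.norm_real, Complex.norm_real, Real.norm_eq_abs, Real.norm_eq_abs, sq_abs,
    sq_abs, Complex.conj_ofReal, RCLike.re_eq_complex_re, Complex.re_ofReal_mul,
    Complex.re_ofReal_mul]
  ring

variable [CompleteSpace X]

theorem isSelfAdjoint_of_mem_Icc {a : X →L[ℂ] X} (ha : a ∈ Set.Icc (-1) 1) :
    IsSelfAdjoint a := by
  simpa only [sub_sub_cancel] using
    (IsSelfAdjoint.one (X →L[ℂ] X)).sub (IsSelfAdjoint.of_nonneg (sub_nonneg.2 ha.2))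

theorem norm_apply_sq {a : X →L[ℂ] X} (ha : IsSelfAdjoint a) (φ : X) :
    ‖a φ‖ ^ 2 = (⟪φ, (a * a) φ⟫_ℂ).re := by
  rw [mul_apply_eq_comp, ← ContinuousLinearMap.adjoint_inner_left,
    ← ContinuousLinearMap.star_eq_adjoint, ha.star_eq]
  exact (inner_self_eq_norm_sq (𝕜 := ℂ) _).symm

theorem re_inner_apply_mono {S T : X →L[ℂ] X} (h : S ≤ T) (φ : X) :
    (⟪φ, S φ⟫_ℂ).re ≤ (⟪φ, T φ⟫_ℂ).re := by
  have hpos :=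
    ((ContinuousLinearMap.nonneg_iff_isPositive _).1 (sub_nonneg.2 h)).re_inner_nonneg_right φ
  rwa [sub_apply, inner_sub_right, map_sub, sub_nonneg] at hpos

theorem norm_apply_le_of_mem_Icc {a : X →L[ℂ] X} (ha : a ∈ Set.Icc (-1) 1) (φ : X) :
    ‖a φ‖ ≤ ‖φ‖ := by
  have hle : a * a ≤ 1 := by
    have hcomm : Commute (1 - a) (a - -1) :=
      ((Commute.one_left _).sub_left ((Commute.refl a).sub_right
        ((Commute.one_right a).neg_right)))
    have h := Commute.mul_nonneg (sub_nonneg.2 ha.2) (sub_nonneg.2 ha.1) hcomm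
    rw [← sub_nonneg]
    convert h using 1
    noncomm_ring
  rw [← sq_le_sq₀ (norm_nonneg _) (norm_nonneg _), norm_apply_sq (isSelfAdjoint_of_mem_Icc ha)]
  refine (re_inner_apply_mono hle φ).trans_eq ?_
  exact inner_self_eq_norm_sq (𝕜 := ℂ) φ

theorem norm_apply_sq_add_norm_apply_sq {e f : X →L[ℂ] X} (he : IsSelfAdjoint e)
    (hf : IsSelfAdjoint f) (hef : e * e + f * f = 1) (φ : X) :
    ‖e φ‖ ^ 2 + ‖f φ‖ ^ 2 = ‖φ‖ ^ 2 := by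
  rw [norm_apply_sq he, norm_apply_sq hf, ← Complex.add_re, ← inner_add_right, ← add_apply, hef,
    one_apply_eq_self]
  exact inner_self_eq_norm_sq (𝕜 := ℂ) φ

theorem smul_one_add_smul_nonneg {x : X →L[ℂ] X} (hx : IsSelfAdjoint x)
    (hx_le : ∀ φ, ‖x φ‖ ≤ ‖φ‖) {r s : ℝ} (hs : |s| ≤ r) :
    0 ≤ (r : ℂ) • (1 : X →L[ℂ] X) + (s : ℂ) • x := by
  rw [ContinuousLinearMap.nonneg_iff_isPositive, ContinuousLinearMap.isPositive_def']
  refine ⟨.add (.smul (Complex.conj_ofReal r) (.one _)) (.smul (Complex.conj_ofReal s) hx),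
    fun φ => ?_⟩
  have hinner : |(⟪x φ, φ⟫_ℂ).re| ≤ ‖φ‖ ^ 2 :=
    calc |(⟪x φ, φ⟫_ℂ).re| ≤ ‖x φ‖ * ‖φ‖ := abs_re_inner_le_norm_mul_norm _ _
      _ ≤ ‖φ‖ * ‖φ‖ := by gcongr; exact hx_le φ
      _ = ‖φ‖ ^ 2 := (sq _).symm
  have hprod : |s * (⟪x φ, φ⟫_ℂ).re| ≤ r * ‖φ‖ ^ 2 := by
    rw [abs_mul]
    exact mul_le_mul hs hinner (abs_nonneg _) ((abs_nonneg s).trans hs)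
  have hre : ((r : ℂ) • (1 : X →L[ℂ] X) + (s : ℂ) • x).reApplyInnerSelf φ =
      r * ‖φ‖ ^ 2 + s * (⟪x φ, φ⟫_ℂ).re := by
    simp [ContinuousLinearMap.reApplyInnerSelf, inner_add_left, inner_smul_left,
      inner_self_eq_norm_sq_to_K, ← Complex.ofReal_pow, -Complex.coe_smul]
  rw [hre]
  linarith [neg_le_of_abs_le hprod]

theorem re_inner_apply_apply_le_of_commute {y B : X →L[ℂ] X} (hy : 0 ≤ y)
    (hB : ∀ φ, ‖B φ‖ ≤ ‖φ‖) (hyB : Commute y B) (φ : X) :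
    (⟪B φ, y (B φ)⟫_ℂ).re ≤ (⟪φ, y φ⟫_ℂ).re := by
  have hcomm : CFC.sqrt y * B = B * CFC.sqrt y := (hyB.cfcₙ_nnreal _).eq
  rw [← CFC.sqrt_mul_sqrt_self y hy, ← norm_apply_sq (CFC.sqrt_nonneg y).isSelfAdjoint,
    ← norm_apply_sq (CFC.sqrt_nonneg y).isSelfAdjoint, ← mul_apply_eq_comp, hcomm,
    mul_apply_eq_comp]
  gcongr
  exact hB _

theorem mul_norm_apply_sq_add_mul_re_inner_le {x B : X →L[ℂ] X} (hx : IsSelfAdjoint x)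
    (hx_le : ∀ φ, ‖x φ‖ ≤ ‖φ‖) (hB : ∀ φ, ‖B φ‖ ≤ ‖φ‖) (hxB : Commute x B) {r s : ℝ}
    (hs : |s| ≤ r) (φ : X) :
    r * ‖B φ‖ ^ 2 + s * (⟪B φ, x (B φ)⟫_ℂ).re ≤ r * ‖φ‖ ^ 2 + s * (⟪φ, x φ⟫_ℂ).re := by
  have hcomm : Commute ((r : ℂ) • (1 : X →L[ℂ] X) + (s : ℂ) • x) B :=
    ((Commute.one_left B).smul_left _).add_left (hxB.smul_left _)
  simpa [inner_add_right, inner_smul_right, inner_self_eq_norm_sq_to_K, ← Complex.ofReal_pow]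
    using re_inner_apply_apply_le_of_commute (smul_one_add_smul_nonneg hx hx_le hs) hB hcomm φ

theorem norm_sq_add_norm_sq_le_of_commute {x w B₀ B₁ : X →L[ℂ] X} (hx : IsSelfAdjoint x)
    (hxw : ∀ φ, ‖x φ‖ ^ 2 + ‖w φ‖ ^ 2 ≤ ‖φ‖ ^ 2) (hB₀ : ∀ φ, ‖B₀ φ‖ ≤ ‖φ‖)
    (hB₁ : ∀ φ, ‖B₁ φ‖ ≤ ‖φ‖) (hxB₀ : Commute x B₀) (hxB₁ : Commute x B₁) {r s : ℝ}
    (hs : |s| ≤ r) (φ : X) :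
    ‖(r : ℂ) • (B₀ + B₁) φ + (s : ℂ) • x ((B₀ - B₁) φ)‖ ^ 2 + (r * ‖w ((B₀ - B₁) φ)‖) ^ 2 ≤
      (2 * r * ‖φ‖) ^ 2 := by
  have hx_le (η : X) : ‖x η‖ ≤ ‖η‖ :=
    (sq_le_sq₀ (norm_nonneg _) (norm_nonneg _)).1
      ((le_add_of_nonneg_right (sq_nonneg _)).trans (hxw η))
  have hr : 0 ≤ r := (abs_nonneg s).trans hs
  have h₀ := mul_norm_apply_sq_add_mul_re_inner_le hx hx_le hB₀ hxB₀ hs φ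
  have h₁ := mul_norm_apply_sq_add_mul_re_inner_le hx hx_le hB₁ hxB₁ ((abs_neg s).trans_le hs) φ
  simp only [add_apply, sub_apply]
  set u := B₀ φ
  set v := B₁ φ
  have hs_sq : s ^ 2 ≤ r ^ 2 := sq_le_sq.2 (hs.trans (le_abs_self r))
  have hxw_diff : s ^ 2 * ‖x (u - v)‖ ^ 2 + r ^ 2 * ‖w (u - v)‖ ^ 2 ≤ r ^ 2 * ‖u - v‖ ^ 2 := by
    nlinarith [mul_le_mul_of_nonneg_right hs_sq (sq_nonneg ‖x (u - v)‖),
      mul_le_mul_of_nonneg_left (hxw (u - v)) (sq_nonneg r)]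
  have hparallelogram : ‖u + v‖ ^ 2 + ‖u - v‖ ^ 2 = 2 * (‖u‖ ^ 2 + ‖v‖ ^ 2) := by
    simpa only [sq] using parallelogram_law_with_norm ℂ u v
  calc ‖(r : ℂ) • (u + v) + (s : ℂ) • x (u - v)‖ ^ 2 + (r * ‖w (u - v)‖) ^ 2
      ≤ r ^ 2 * (‖u + v‖ ^ 2 + ‖u - v‖ ^ 2) +
          2 * r * s * ((⟪u, x u⟫_ℂ).re - (⟪v, x v⟫_ℂ).re) := by
        rw [norm_smul_add_smul_sq, re_inner_add_apply_sub hx.isSymmetric]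
        linarith
    _ = 2 * r * ((r * ‖u‖ ^ 2 + s * (⟪u, x u⟫_ℂ).re) +
          (r * ‖v‖ ^ 2 + -s * (⟪v, x v⟫_ℂ).re)) := by
        rw [hparallelogram]
        ring
    _ ≤ 2 * r * ((r * ‖φ‖ ^ 2 + s * (⟪φ, x φ⟫_ℂ).re) +
          (r * ‖φ‖ ^ 2 + -s * (⟪φ, x φ⟫_ℂ).re)) := by gcongr
    _ = (2 * r * ‖φ‖) ^ 2 := by ring

theorem re_inner_apply_eq_add_of_sq_add_sq_eq_one {c e f : X →L[ℂ] X} (hc : IsSelfAdjoint c)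
    (he : IsSelfAdjoint e) (hf : IsSelfAdjoint f) (hef : e * e + f * f = 1) (ψ : X) :
    (⟪ψ, c ψ⟫_ℂ).re = (⟪e ψ, (e * c * e) (e ψ)⟫_ℂ).re + (⟪f ψ, (f * c * f) (f ψ)⟫_ℂ).re +
      2 * (⟪f ψ, (f * c * e) (e ψ)⟫_ℂ).re := by
  have hψ : e (e ψ) + f (f ψ) = ψ := by
    simpa only [add_apply, mul_apply_eq_comp, one_apply_eq_self] using DFunLike.congr_fun hef ψ
  have hcross : (⟪e (e ψ), c (f (f ψ))⟫_ℂ).re = (⟪f (f ψ), c (e (e ψ))⟫_ℂ).re := by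
    rw [← Complex.conj_re, inner_conj_symm]
    exact congrArg Complex.re (hc.isSymmetric _ _)
  conv_lhs => rw [← hψ]
  have he' (x y : X) : ⟪x, e y⟫_ℂ = ⟪e x, y⟫_ℂ := (he.isSymmetric x y).symm
  have hf' (x y : X) : ⟪x, f y⟫_ℂ = ⟪f x, y⟫_ℂ := (hf.isSymmetric x y).symm
  simp only [mul_apply_eq_comp, he', hf', map_add, inner_add_left, inner_add_right,
    Complex.add_re, hcross]
  ring

theorem mul_add_mul_le_of_sq_add_sq_le {n d r N k p : ℝ} (hr : 0 < r) (hp : 0 ≤ p)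
    (h : N ^ 2 + (r * k) ^ 2 ≤ (2 * r * p) ^ 2) :
    n * N + d * k ≤ 2 * p * √((r * n) ^ 2 + d ^ 2) := by
  have hcs : (r * (n * N + d * k)) ^ 2 ≤ (r * (2 * p * √((r * n) ^ 2 + d ^ 2))) ^ 2 :=
    calc (r * (n * N + d * k)) ^ 2
        ≤ ((r * n) ^ 2 + d ^ 2) * (N ^ 2 + (r * k) ^ 2) := by
          linarith [sq_nonneg (r * n * (r * k) - d * N)]
      _ ≤ ((r * n) ^ 2 + d ^ 2) * (2 * r * p) ^ 2 := by gcongr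
      _ = (r * (2 * p * √((r * n) ^ 2 + d ^ 2))) ^ 2 := by
          rw [mul_pow r (_ * _), mul_pow (2 * p), Real.sq_sqrt (by positivity)]
          ring
  exact le_of_mul_le_mul_left (abs_le_of_sq_le_sq' hcs (by positivity)).2 hr

/-- Multiplying the bound on `|v|` by `p² + q²` and distributing the cross term `t` over both
columns reduces the claim to Cauchy–Schwarz in each column. -/
theorem sq_le_of_abs_le_column_bounds {p q r s t v N₁ N₂ k₁ k₂ : ℝ} (hp : 0 ≤ p) (hq : 0 ≤ q)
    (hr : 0 < r) (hs : 0 ≤ s) (hv : |v| ≤ p * N₁ + q * N₂ + 2 * s * |t|)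
    (ht₁ : |t| ≤ q * k₁) (ht₂ : |t| ≤ p * k₂)
    (h₁ : N₁ ^ 2 + (r * k₁) ^ 2 ≤ (2 * r * p) ^ 2)
    (h₂ : N₂ ^ 2 + (r * k₂) ^ 2 ≤ (2 * r * q) ^ 2) :
    v ^ 2 ≤ 4 * ((r * (p ^ 2 + q ^ 2)) ^ 2 + (2 * s * p * q) ^ 2) := by
  set n := p ^ 2 + q ^ 2
  set d := 2 * s * p * q
  set R := √((r * n) ^ 2 + d ^ 2)
  have hR : R ^ 2 = (r * n) ^ 2 + d ^ 2 := Real.sq_sqrt (by positivity)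
  suffices |v| ≤ 2 * R by
    rw [← hR, ← sq_abs]
    nlinarith [abs_nonneg v]
  rcases (by positivity : 0 ≤ n).eq_or_lt' with hn | hn
  · obtain ⟨hp₀, hq₀⟩ := (add_eq_zero_iff_of_nonneg (sq_nonneg p) (sq_nonneg q)).1 hn
    rw [pow_eq_zero_iff two_ne_zero] at hp₀ hq₀
    rw [hq₀, zero_mul] at ht₁
    rw [hp₀, hq₀, le_antisymm ht₁ (abs_nonneg t)] at hv
    linarith [Real.sqrt_nonneg ((r * n) ^ 2 + d ^ 2)]
  · have hcross : n * (2 * s * |t|) ≤ p * (d * k₁) + q * (d * k₂) :=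
      calc n * (2 * s * |t|) = 2 * s * p ^ 2 * |t| + 2 * s * q ^ 2 * |t| := by ring
        _ ≤ 2 * s * p ^ 2 * (q * k₁) + 2 * s * q ^ 2 * (p * k₂) := by gcongr
        _ = p * (d * k₁) + q * (d * k₂) := by ring
    refine le_of_mul_le_mul_left ?_ hn
    calc n * |v| ≤ n * (p * N₁ + q * N₂ + 2 * s * |t|) := by gcongr
      _ ≤ p * (n * N₁ + d * k₁) + q * (n * N₂ + d * k₂) := by linarith
      _ ≤ p * (2 * p * R) + q * (2 * q * R) := by
          gcongr
          exacts [mul_add_mul_le_of_sq_add_sq_le hr hp h₁,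
            mul_add_mul_le_of_sq_add_sq_le hr hq h₂]
      _ = n * (2 * R) := by ring

theorem norm_conj_apply_sq_add_norm_conj_apply_sq_le {a e f : X →L[ℂ] X}
    (ha : a ∈ Set.Icc (-1) 1) (he : IsSelfAdjoint e) (hf : IsSelfAdjoint f)
    (hef : e * e + f * f = 1) (φ : X) :
    ‖(e * a * e) φ‖ ^ 2 + ‖(f * a * e) φ‖ ^ 2 ≤ ‖φ‖ ^ 2 :=
  calc ‖(e * a * e) φ‖ ^ 2 + ‖(f * a * e) φ‖ ^ 2
      = ‖a (e φ)‖ ^ 2 := norm_apply_sq_add_norm_apply_sq he hf hef (a (e φ))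
    _ ≤ ‖e φ‖ ^ 2 := by gcongr; exact norm_apply_le_of_mem_Icc ha _
    _ ≤ ‖φ‖ ^ 2 := by
        rw [← norm_apply_sq_add_norm_apply_sq he hf hef φ]
        exact le_add_of_nonneg_right (sq_nonneg _)

theorem norm_compression_sq_add_norm_sq_le {e f a B₀ B₁ : X →L[ℂ] X} (he : IsSelfAdjoint e)
    (hf : IsSelfAdjoint f) (hef : e * e + f * f = 1) (ha : a ∈ Set.Icc (-1) 1)
    (hB₀ : B₀ ∈ Set.Icc (-1) 1) (hB₁ : B₁ ∈ Set.Icc (-1) 1) (he₀ : Commute e B₀)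
    (he₁ : Commute e B₁) (ha₀ : Commute a B₀) (ha₁ : Commute a B₁) {r s : ℝ} (hs : |s| ≤ r)
    (φ : X) :
    ‖(r : ℂ) • (B₀ + B₁) φ + (s : ℂ) • (e * a * e) ((B₀ - B₁) φ)‖ ^ 2 +
        (r * ‖(f * a * e) ((B₀ - B₁) φ)‖) ^ 2 ≤ (2 * r * ‖φ‖) ^ 2 := by
  have heae : IsSelfAdjoint (e * a * e) := by
    simpa only [he.star_eq] using (isSelfAdjoint_of_mem_Icc ha).conjugate e
  exact norm_sq_add_norm_sq_le_of_commute heae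
    (norm_conj_apply_sq_add_norm_conj_apply_sq_le ha he hf hef) (norm_apply_le_of_mem_Icc hB₀)
    (norm_apply_le_of_mem_Icc hB₁) ((he₀.mul_left ha₀).mul_left he₀)
    ((he₁.mul_left ha₁).mul_left he₁) hs φ

theorem re_inner_sq_sub_sq_mul {e f S : X →L[ℂ] X} (he : IsSelfAdjoint e)
    (hf : IsSelfAdjoint f) (heS : Commute e S) (hfS : Commute f S) (ψ : X) :
    (⟪ψ, ((e * e - f * f) * S) ψ⟫_ℂ).re = (⟪e ψ, S (e ψ)⟫_ℂ).re - (⟪f ψ, S (f ψ)⟫_ℂ).re := by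
  have hmul : (e * e - f * f) * S = e * S * e - f * S * f := by
    simp only [sub_mul, mul_assoc, ← heS.eq, ← hfS.eq]
  have he' (x y : X) : ⟪x, e y⟫_ℂ = ⟪e x, y⟫_ℂ := (he.isSymmetric x y).symm
  have hf' (x y : X) : ⟪x, f y⟫_ℂ = ⟪f x, y⟫_ℂ := (hf.isSymmetric x y).symm
  rw [hmul, sub_apply, inner_sub_right, Complex.sub_re]
  simp only [mul_apply_eq_comp, he', hf']

theorem re_inner_mul_eq_add_of_sq_add_sq_eq_one {a D e f : X →L[ℂ] X} (ha : IsSelfAdjoint a)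
    (hD : IsSelfAdjoint D) (he : IsSelfAdjoint e) (hf : IsSelfAdjoint f)
    (hef : e * e + f * f = 1) (haD : Commute a D) (heD : Commute e D) (hfD : Commute f D)
    (ψ : X) :
    (⟪ψ, (a * D) ψ⟫_ℂ).re = (⟪e ψ, (e * a * e) (D (e ψ))⟫_ℂ).re +
      (⟪f ψ, (f * a * f) (D (f ψ))⟫_ℂ).re + 2 * (⟪f ψ, (f * a * e) (D (e ψ))⟫_ℂ).re := by
  have hmove {u v : X →L[ℂ] X} (hv : Commute v D) : u * (a * D) * v = u * a * v * D := by
    simp only [mul_assoc, hv.eq]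
  have haD_adj : IsSelfAdjoint (a * D) := (ha.commute_iff hD).1 haD
  rw [re_inner_apply_eq_add_of_sq_add_sq_eq_one haD_adj he hf hef ψ, hmove heD, hmove heD,
    hmove hfD]
  rfl

theorem sq_re_inner_le_of_sq_add_sq_eq_one {e f a B₀ B₁ : X →L[ℂ] X} (he : IsSelfAdjoint e)
    (hf : IsSelfAdjoint f) (hef : e * e + f * f = 1) (ha : a ∈ Set.Icc (-1) 1)
    (hB₀ : B₀ ∈ Set.Icc (-1) 1) (hB₁ : B₁ ∈ Set.Icc (-1) 1)
    (he₀ : Commute e B₀) (he₁ : Commute e B₁) (hf₀ : Commute f B₀) (hf₁ : Commute f B₁)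
    (ha₀ : Commute a B₀) (ha₁ : Commute a B₁) {r s : ℝ} (hr : 0 < r) (hs : 0 ≤ s)
    (hsr : s ≤ r) (ψ : X) :
    (r * (⟪ψ, ((e * e - f * f) * (B₀ + B₁)) ψ⟫_ℂ).re +
        s * (⟪ψ, (a * (B₀ - B₁)) ψ⟫_ℂ).re) ^ 2 ≤
      4 * ((r * (‖e ψ‖ ^ 2 + ‖f ψ‖ ^ 2)) ^ 2 + (2 * s * ‖e ψ‖ * ‖f ψ‖) ^ 2) := by
  have ha_adj := isSelfAdjoint_of_mem_Icc ha
  have hD := (isSelfAdjoint_of_mem_Icc hB₀).sub (isSelfAdjoint_of_mem_Icc hB₁)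
  have hfe : f * f + e * e = 1 := by rwa [add_comm]
  have hexpand := re_inner_mul_eq_add_of_sq_add_sq_eq_one ha_adj hD he hf hef
    (ha₀.sub_right ha₁) (he₀.sub_right he₁) (hf₀.sub_right hf₁) ψ
  have hexpand_swap := re_inner_mul_eq_add_of_sq_add_sq_eq_one ha_adj hD hf he hfe
    (ha₀.sub_right ha₁) (hf₀.sub_right hf₁) (he₀.sub_right he₁) ψ
  have hcol₁ := norm_compression_sq_add_norm_sq_le he hf hef ha hB₀ hB₁ he₀ he₁ ha₀ ha₁
    ((abs_of_nonneg hs).trans_le hsr) (e ψ)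
  have hcol₂ := norm_compression_sq_add_norm_sq_le hf he hfe ha hB₀ hB₁ hf₀ hf₁ ha₀ ha₁
    (((abs_neg s).trans (abs_of_nonneg hs)).trans_le hsr) (f ψ)
  rw [re_inner_sq_sub_sq_mul he hf (he₀.add_right he₁) (hf₀.add_right hf₁), hexpand]
  set S := B₀ + B₁
  set D := B₀ - B₁
  set t := (⟪f ψ, (f * a * e) (D (e ψ))⟫_ℂ).re
  have ht_swap : t = (⟪e ψ, (e * a * f) (D (f ψ))⟫_ℂ).re := by linarith
  refine sq_le_of_abs_le_column_bounds (norm_nonneg (e ψ)) (norm_nonneg (f ψ)) hr hs (t := t) ?_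
    (abs_re_inner_le_norm_mul_norm _ _) (ht_swap ▸ abs_re_inner_le_norm_mul_norm _ _) hcol₁ hcol₂
  have h₁ := abs_re_inner_le_norm_mul_norm (e ψ)
    ((r : ℂ) • S (e ψ) + (s : ℂ) • (e * a * e) (D (e ψ)))
  have h₂ := abs_re_inner_le_norm_mul_norm (f ψ)
    ((r : ℂ) • S (f ψ) + ((-s : ℝ) : ℂ) • (f * a * f) (D (f ψ)))
  rw [inner_add_right, inner_smul_right, inner_smul_right, Complex.add_re, Complex.re_ofReal_mul,
    Complex.re_ofReal_mul] at h₁ h₂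
  rw [abs_le] at h₁ h₂ ⊢
  constructor <;> nlinarith [neg_abs_le t, le_abs_self t]

theorem exists_sq_add_sq_eq_one_and_sq_sub_sq_eq {A : X →L[ℂ] X} (hA : A ∈ Set.Icc (-1) 1) :
    ∃ e f : X →L[ℂ] X, IsSelfAdjoint e ∧ IsSelfAdjoint f ∧ e * e + f * f = 1 ∧
      e * e - f * f = A ∧ ∀ B, Commute A B → Commute e B ∧ Commute f B := by
  set E := (2⁻¹ : ℝ) • (1 + A) with hE
  set F := (2⁻¹ : ℝ) • (1 - A) with hF
  have hE_nonneg : 0 ≤ E :=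
    smul_nonneg (by norm_num) (by simpa only [sub_neg_eq_add, add_comm] using sub_nonneg.2 hA.1)
  have hF_nonneg : 0 ≤ F := smul_nonneg (by norm_num) (sub_nonneg.2 hA.2)
  refine ⟨CFC.sqrt E, CFC.sqrt F, (CFC.sqrt_nonneg E).isSelfAdjoint,
    (CFC.sqrt_nonneg F).isSelfAdjoint, ?_, ?_, fun B hB =>
    ⟨(((Commute.one_left B).add_left hB).smul_left _).cfcₙ_nnreal _,
      (((Commute.one_left B).sub_left hB).smul_left _).cfcₙ_nnreal _⟩⟩
  all_goals
    rw [CFC.sqrt_mul_sqrt_self E hE_nonneg, CFC.sqrt_mul_sqrt_self F hF_nonneg, hE, hF]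
    module

theorem sq_re_inner_add_sq_re_inner_le {A a B₀ B₁ : X →L[ℂ] X} (hA : A ∈ Set.Icc (-1) 1)
    (ha : a ∈ Set.Icc (-1) 1) (hB₀ : B₀ ∈ Set.Icc (-1) 1) (hB₁ : B₁ ∈ Set.Icc (-1) 1)
    (hA₀ : Commute A B₀) (hA₁ : Commute A B₁) (ha₀ : Commute a B₀) (ha₁ : Commute a B₁)
    {r s : ℝ} (hr : 0 < r) (hs : 0 ≤ s) (hsr : s ≤ r) (ψ : X) :
    ((r * (⟪ψ, (A * (B₀ + B₁)) ψ⟫_ℂ).re + s * (⟪ψ, (a * (B₀ - B₁)) ψ⟫_ℂ).re) / 2) ^ 2 +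
        (s * (⟪ψ, A ψ⟫_ℂ).re) ^ 2 ≤ (r ^ 2 + s ^ 2) * (‖ψ‖ ^ 2) ^ 2 := by
  obtain ⟨e, f, he, hf, hef, hA_eq, hcomm⟩ := exists_sq_add_sq_eq_one_and_sq_sub_sq_eq hA
  have hA_inner : (⟪ψ, A ψ⟫_ℂ).re = ‖e ψ‖ ^ 2 - ‖f ψ‖ ^ 2 := by
    rw [norm_apply_sq he, norm_apply_sq hf, ← Complex.sub_re, ← inner_sub_right, ← sub_apply,
      hA_eq]
  have hbound := sq_re_inner_le_of_sq_add_sq_eq_one he hf hef ha hB₀ hB₁ (hcomm B₀ hA₀).1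
    (hcomm B₁ hA₁).1 (hcomm B₀ hA₀).2 (hcomm B₁ hA₁).2 ha₀ ha₁ hr hs hsr ψ
  rw [hA_eq] at hbound
  rw [hA_inner, ← norm_apply_sq_add_norm_apply_sq he hf hef ψ]
  linarith

end OperatorBound

section Observable

variable {X : Type} [NormedAddCommGroup X] [InnerProductSpace ℂ X]

/-- The observable of a two-outcome measurement whose outcomes `0` and `1` have values `1` and
`-1`. -/
def observable (M : Fin 2 → (X →L[ℂ] X)) : X →L[ℂ] X := M 0 - M 1

theorem IsPOVM.observable_mem_Icc [CompleteSpace X] {M : Fin 2 → (X →L[ℂ] X)} (hM : IsPOVM M) :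
    observable M ∈ Set.Icc (-1) 1 := by
  have hsum : M 0 + M 1 = 1 := by rw [← Fin.sum_univ_two, hM.2]
  rw [← hsum, observable, neg_add, sub_eq_add_neg]
  exact ⟨add_le_add_left (neg_le_self (hM.nonneg 0)) _,
    add_le_add_right (neg_le_self (hM.nonneg 1)) _⟩

theorem CommutingMeasurements.commute_observable {M N : Fin 2 → Fin 2 → (X →L[ℂ] X)}
    (h : CommutingMeasurements M N) (x y : Fin 2) :
    Commute (observable (M x)) (observable (N y)) :=
  ((h.commute x 0 y 0).sub_right (h.commute x 0 y 1)).sub_left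
    ((h.commute x 1 y 0).sub_right (h.commute x 1 y 1))

end Observable

section Correlator

/-- The expectation of `(-1) ^ (a + b)` for the inputs `x` and `y`. -/
def correlator (P : Behavior) (x y : Fin 2) : ℝ :=
  ∑ a : Fin 2, ∑ b : Fin 2, (-1 : ℝ) ^ (a.val + b.val) * P a b x y

theorem score_eq_sum_correlator (π : Fin 2 → Fin 2 → ℝ) (P : Behavior) :
    score π P = 4 * ∑ x : Fin 2, ∑ y : Fin 2,
      π x y * (-1 : ℝ) ^ (x.val * y.val) * correlator P x y := by
  simp only [score, correlator, Fin.sum_univ_two, pow_add]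
  ring

theorem score_biasedInputs (r : ℝ) (xs : Fin 2) (P : Behavior) :
    score (biasedInputs r xs) P =
      2 * (r * (correlator P xs 0 + (-1) ^ xs.val * correlator P xs 1) +
        (1 - r) * (correlator P (1 - xs) 0 - (-1) ^ xs.val * correlator P (1 - xs) 1)) := by
  rw [score_eq_sum_correlator]
  fin_cases xs <;>
    simp only [biasedInputs, Fin.sum_univ_two, Fin.zero_eta, Fin.mk_one, Fin.val_zero, Fin.val_one,
      sub_zero, sub_self, zero_ne_one, one_ne_zero, if_true, if_false, mul_zero, mul_one, pow_zero,
      pow_one] <;>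
    ring

theorem hasSum_score {ι : Type*} {p : ι → Behavior} {P : Behavior}
    (h : ∀ a b x y, HasSum (fun j => p j a b x y) (P a b x y)) (π : Fin 2 → Fin 2 → ℝ) :
    HasSum (fun j => score π (p j)) (score π P) :=
  (hasSum_sum fun a _ => hasSum_sum fun b _ => hasSum_sum fun x _ => hasSum_sum fun y _ =>
    ((h a b x y).mul_left _).mul_right _).mul_left _

theorem hasSum_marginal {ι : Type*} {p : ι → Behavior} {P : Behavior}
    (h : ∀ a b x y, HasSum (fun j => p j a b x y) (P a b x y)) (a x : Fin 2) :
    HasSum (fun j => marginal (p j) a x) (marginal P a x) :=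
  hasSum_sum fun b _ => h a b x 0

theorem score_const_mul (π : Fin 2 → Fin 2 → ℝ) (q : ℝ) (P : Behavior) :
    score π (fun a b x y => q * P a b x y) = q * score π P := by
  simp only [score, Fin.sum_univ_two]
  ring

end Correlator

section VectorBehavior

variable {X : Type} [NormedAddCommGroup X] [InnerProductSpace ℂ X]
  {M N : Fin 2 → Fin 2 → (X →L[ℂ] X)}

theorem correlator_vectorBehavior (M N : Fin 2 → Fin 2 → (X →L[ℂ] X)) (ψ : X) (x y : Fin 2) :
    correlator (vectorBehavior M N ψ) x y =
      (⟪ψ, (observable (M x) * observable (N y)) ψ⟫_ℂ).re := by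
  simp only [correlator, vectorBehavior, observable, Fin.sum_univ_two, sub_mul, mul_sub,
    sub_apply, inner_sub_right, Complex.sub_re, Fin.val_zero, Fin.val_one, pow_add, pow_zero,
    pow_one]
  ring

theorem sum_vectorBehavior (h : CommutingMeasurements M N) (ψ : X) (x y : Fin 2) :
    ∑ a, ∑ b, vectorBehavior M N ψ a b x y = ‖ψ‖ ^ 2 := by
  simp only [vectorBehavior, ← Complex.re_sum, ← inner_sum, ← sum_apply, ← Finset.mul_sum,
    (h.right y).2, mul_one, (h.left x).2]
  exact inner_self_eq_norm_sq (𝕜 := ℂ) ψ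

theorem marginal_vectorBehavior (h : CommutingMeasurements M N) (ψ : X) (a x : Fin 2) :
    marginal (vectorBehavior M N ψ) a x = (⟪ψ, M x a ψ⟫_ℂ).re := by
  simp only [marginal, vectorBehavior, ← Complex.re_sum, ← inner_sum, ← sum_apply,
    ← Finset.mul_sum, (h.right 0).2, mul_one]

theorem vectorBehavior_nonneg [CompleteSpace X] (h : CommutingMeasurements M N) (ψ : X)
    (a b x y : Fin 2) : 0 ≤ vectorBehavior M N ψ a b x y := by
  have hpos := (h.commute x a y b).mul_nonneg ((h.left x).nonneg a) ((h.right y).nonneg b)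
  exact ((ContinuousLinearMap.nonneg_iff_isPositive _).1 hpos).re_inner_nonneg_right ψ

theorem sq_score_add_sq_marginal_vectorBehavior_le [CompleteSpace X]
    (h : CommutingMeasurements M N) {r : ℝ} (hr : 1 / 2 ≤ r) (hr₁ : r ≤ 1) (xs : Fin 2) (ψ : X) :
    (score (biasedInputs r xs) (vectorBehavior M N ψ) / 4) ^ 2 +
        ((1 - r) * (marginal (vectorBehavior M N ψ) 0 xs -
          marginal (vectorBehavior M N ψ) 1 xs)) ^ 2 ≤
      (r ^ 2 + (1 - r) ^ 2) * (‖ψ‖ ^ 2) ^ 2 := by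
  have hB₁ : (-1 : ℝ) ^ xs.val • observable (N 1) ∈ Set.Icc (-1) 1 := by
    obtain ⟨hlo, hhi⟩ := (h.right 1).observable_mem_Icc
    rcases neg_one_pow_eq_or ℝ xs.val with hxs | hxs <;> rw [hxs]
    · rw [one_smul]
      exact ⟨hlo, hhi⟩
    · rw [neg_one_smul]
      exact ⟨neg_le_neg hhi, neg_le.1 hlo⟩
  convert! sq_re_inner_add_sq_re_inner_le (h.left xs).observable_mem_Icc
    (h.left (1 - xs)).observable_mem_Icc (h.right 0).observable_mem_Icc hB₁
    (h.commute_observable xs 0) ((h.commute_observable xs 1).smul_right _)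
    (h.commute_observable (1 - xs) 0) ((h.commute_observable (1 - xs) 1).smul_right _)
    (by linarith) (by linarith) (by linarith : 1 - r ≤ r) ψ using 3
  · simp only [score_biasedInputs, correlator_vectorBehavior, mul_add, mul_sub, add_apply,
      sub_apply, mul_smul_comm, smul_apply, inner_add_right, inner_sub_right,
      inner_smul_right_eq_smul, Complex.add_re, Complex.sub_re, Complex.smul_re, smul_eq_mul]
    ring
  · simp only [marginal_vectorBehavior h, observable, sub_apply, inner_sub_right, Complex.sub_re]

end VectorBehavior

section UpperBound

theorem sq_add_sq_le_of_hasSum {ι : Type*} {f g h : ι → ℝ} {a b c C : ℝ} (hC : 0 ≤ C)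
    (hf : HasSum f a) (hg : HasSum g b) (hh : HasSum h c) (hh₀ : ∀ i, 0 ≤ h i)
    (hle : ∀ i, f i ^ 2 + g i ^ 2 ≤ C * h i ^ 2) : a ^ 2 + b ^ 2 ≤ C * c ^ 2 := by
  have hsq (u v : ℝ) : ‖(⟨u, v⟩ : ℂ)‖ ^ 2 = u ^ 2 + v ^ 2 := by
    rw [Complex.sq_norm, Complex.normSq_mk, ← sq, ← sq]
  have hnorm : ‖(⟨a, b⟩ : ℂ)‖ ≤ √C * c := by
    refine HasSum.norm_le_of_bounded (f := fun i => (⟨f i, g i⟩ : ℂ))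
      ((Complex.hasSum_iff _ _).2 ⟨hf, hg⟩) (hh.mul_left √C) fun i => ?_
    refine le_of_sq_le_sq ?_ (by have := hh₀ i; positivity)
    rw [hsq, mul_pow, Real.sq_sqrt hC]
    exact hle i
  rw [← hsq, ← Real.sq_sqrt hC, ← mul_pow]
  gcongr

theorem IsQuantum.nonneg {P : Behavior} (hP : IsQuantum P) (a b x y : Fin 2) :
    0 ≤ P a b x y := by
  obtain ⟨X, _, _, _, M, N, ι, ψ, hMN, -, hsum⟩ := hP.exists_commutingMeasurements
  exact (hsum a b x y).nonneg fun j => vectorBehavior_nonneg hMN (ψ j) a b x y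

theorem IsQuantum.sum_eq_one {P : Behavior} (hP : IsQuantum P) (x y : Fin 2) :
    ∑ a, ∑ b, P a b x y = 1 := by
  obtain ⟨X, _, _, _, M, N, ι, ψ, hMN, hψ, hsum⟩ := hP.exists_commutingMeasurements
  refine (hasSum_sum fun a _ => hasSum_sum fun b _ => hsum a b x y).unique ?_
  simpa only [sum_vectorBehavior hMN] using hψ

theorem IsQuantum.le_one {P : Behavior} (hP : IsQuantum P) (a b x y : Fin 2) :
    P a b x y ≤ 1 := by
  rw [← hP.sum_eq_one x y]
  calc P a b x y ≤ ∑ b, P a b x y :=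
        Finset.single_le_sum (fun b _ => hP.nonneg a b x y) (Finset.mem_univ b)
    _ ≤ ∑ a, ∑ b, P a b x y :=
        Finset.single_le_sum (f := fun a => ∑ b, P a b x y)
          (fun a _ => Finset.sum_nonneg fun b _ => hP.nonneg a b x y) (Finset.mem_univ a)

theorem IsQuantum.marginal_nonneg {P : Behavior} (hP : IsQuantum P) (a x : Fin 2) :
    0 ≤ marginal P a x :=
  Finset.sum_nonneg fun b _ => hP.nonneg a b x 0

theorem IsQuantum.marginal_add {P : Behavior} (hP : IsQuantum P) (x : Fin 2) :
    marginal P 0 x + marginal P 1 x = 1 := by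
  rw [← hP.sum_eq_one x 0, Fin.sum_univ_two]
  rfl

theorem IsQuantum.abs_marginal_sub_le_one {P : Behavior} (hP : IsQuantum P) (x : Fin 2) :
    |marginal P 0 x - marginal P 1 x| ≤ 1 :=
  abs_le.2 ⟨by linarith [hP.marginal_nonneg 0 x, hP.marginal_add x],
    by linarith [hP.marginal_nonneg 1 x, hP.marginal_add x]⟩

theorem IsQuantum.sq_score_add_sq_marginal_le {P : Behavior} (hP : IsQuantum P) {r : ℝ}
    (hr : 1 / 2 ≤ r) (hr₁ : r ≤ 1) (xs : Fin 2) :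
    (score (biasedInputs r xs) P / 4) ^ 2 +
        ((1 - r) * (marginal P 0 xs - marginal P 1 xs)) ^ 2 ≤ r ^ 2 + (1 - r) ^ 2 := by
  obtain ⟨X, _, _, _, M, N, ι, ψ, hMN, hψ, hsum⟩ := hP.exists_commutingMeasurements
  have hscore := (hasSum_score hsum (biasedInputs r xs)).div_const 4
  have hmarginal := ((hasSum_marginal hsum 0 xs).sub (hasSum_marginal hsum 1 xs)).mul_left (1 - r)
  simpa only [one_pow, mul_one] using
    sq_add_sq_le_of_hasSum (by positivity) hscore hmarginal hψ (fun _ => sq_nonneg _)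
      fun j => sq_score_add_sq_marginal_vectorBehavior_le hMN hr hr₁ xs (ψ j)

theorem hasSum_average {Λ : Type} {q : Λ → ℝ} {P : Λ → Behavior} (hq : ∀ l, 0 ≤ q l)
    (hq₁ : Summable q) (hP : ∀ l, IsQuantum (P l)) (a b x y : Fin 2) :
    HasSum (fun l => q l * P l a b x y) (average q P a b x y) :=
  (hq₁.of_nonneg_of_le (fun l => mul_nonneg (hq l) ((hP l).nonneg a b x y))
    fun l => mul_le_of_le_one_right (hq l) ((hP l).le_one a b x y)).hasSum

theorem max_eq_half_of_add_eq_one {a b : ℝ} (h : a + b = 1) :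
    max a b = 1 / 2 * (1 + |a - b|) := by
  rw [max_def]
  split_ifs with hab
  · rw [abs_of_nonpos (sub_nonpos.2 hab)]
    linarith
  · rw [abs_of_pos (sub_pos.2 (not_le.1 hab))]
    linarith

/-- Here `m` is the average over the hidden variable of `|P(0|xs) - P(1|xs)|`. -/
theorem exists_eq_half_of_mem_guessingValues {xs : Fin 2} {r S g : ℝ} (hr : 1 / 2 ≤ r)
    (hr₁ : r ≤ 1) (hg : g ∈ guessingValues (score (biasedInputs r xs)) xs S) :
    ∃ m, g = 1 / 2 * (1 + m) ∧ (S / 4) ^ 2 + ((1 - r) * m) ^ 2 ≤ r ^ 2 + (1 - r) ^ 2 := by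
  obtain ⟨Λ, q, P, hq, hq₁, hP, rfl, rfl⟩ := hg
  let bias (l : Λ) : ℝ := |marginal (P l) 0 xs - marginal (P l) 1 xs|
  have hbias : HasSum (fun l => q l * bias l) (∑' l, q l * bias l) :=
    (hq₁.summable.of_nonneg_of_le (fun l => mul_nonneg (hq l) (abs_nonneg _))
      fun l => mul_le_of_le_one_right (hq l) ((hP l).abs_marginal_sub_le_one xs)).hasSum
  have hscore := hasSum_score (hasSum_average hq hq₁.summable hP) (biasedInputs r xs)
  simp only [score_const_mul] at hscore
  refine ⟨∑' l, q l * bias l, ?_, ?_⟩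
  · rw [← ((hq₁.add hbias).mul_left (1 / 2)).tsum_eq]
    refine tsum_congr fun l => ?_
    rw [max_eq_half_of_add_eq_one ((hP l).marginal_add xs)]
    ring
  · have hle (l : Λ) : (q l * score (biasedInputs r xs) (P l) / 4) ^ 2 +
        ((1 - r) * (q l * bias l)) ^ 2 ≤ (r ^ 2 + (1 - r) ^ 2) * q l ^ 2 := by
      have h := mul_le_mul_of_nonneg_left ((hP l).sq_score_add_sq_marginal_le hr hr₁ xs)
        (sq_nonneg (q l))
      rw [mul_pow _ (marginal _ _ _ - _), ← sq_abs (marginal _ _ _ - _)] at h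
      linarith
    simpa only [one_pow, mul_one] using sq_add_sq_le_of_hasSum (by positivity)
      (hscore.div_const 4) (hbias.mul_left (1 - r)) hq₁ hq hle

theorem guessingValues_le_guessFormula {xs : Fin 2} {r S g : ℝ} (hr : 1 / 2 ≤ r) (hr₁ : r < 1)
    (hg : g ∈ guessingValues (score (biasedInputs r xs)) xs S) : g ≤ guessFormula r S := by
  obtain ⟨m, rfl, hm⟩ := exists_eq_half_of_mem_guessingValues hr hr₁.le hg
  have : 0 < 1 - r := sub_pos.2 hr₁
  rw [guessFormula]
  gcongr
  refine Real.le_sqrt_of_sq_le ?_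
  rw [le_sub_iff_add_le, one_div_mul_eq_div, ← le_sub_iff_add_le', div_le_iff₀ (by positivity)]
  linarith

end UpperBound

section Attainment

theorem inner_mapL_rankOne_apply {H K : Type*} [NormedAddCommGroup H] [InnerProductSpace ℂ H]
    [NormedAddCommGroup K] [InnerProductSpace ℂ K] (u : H) (v : K) (φ ψ : H ⊗[ℂ] K) :
    ⟪φ, TensorProduct.mapL (rankOne ℂ u u) (rankOne ℂ v v) ψ⟫_ℂ =
      ⟪φ, u ⊗ₜ[ℂ] v⟫_ℂ * ⟪u ⊗ₜ[ℂ] v, ψ⟫_ℂ := by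
  induction ψ with
  | zero => rw [map_zero, inner_zero_right, inner_zero_right, mul_zero]
  | add ψ ψ' hψ hψ' => rw [map_add, inner_add_right, inner_add_right, mul_add, hψ, hψ']
  | tmul x y =>
    induction φ with
    | zero => simp only [inner_zero_left, zero_mul]
    | add φ φ' hφ hφ' => rw [inner_add_left, inner_add_left, add_mul, hφ, hφ']
    | tmul x' y' =>
      simp only [TensorProduct.mapL_tmul, InnerProductSpace.rankOne_apply,
        TensorProduct.inner_tmul, inner_smul_right]
      ring

theorem isQuantum_of_sum_rankOne_eq_one {H K : Type} [NormedAddCommGroup H]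
    [InnerProductSpace ℂ H] [CompleteSpace H] [NormedAddCommGroup K] [InnerProductSpace ℂ K]
    [CompleteSpace K] {u : Fin 2 → Fin 2 → H} {v : Fin 2 → Fin 2 → K}
    (hu : ∀ x, ∑ a, rankOne ℂ (u x a) (u x a) = 1)
    (hv : ∀ y, ∑ b, rankOne ℂ (v y b) (v y b) = 1)
    {ψ : H ⊗[ℂ] K} (hψ : ‖ψ‖ = 1) :
    IsQuantum fun a b x y => ‖⟪u x a ⊗ₜ[ℂ] v y b, ψ⟫_ℂ‖ ^ 2 := by
  refine ⟨H, _, _, ‹_›, K, _, _, ‹_›, fun x a => rankOne ℂ (u x a) (u x a),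
    fun y b => rankOne ℂ (v y b) (v y b),
    rankOne ℂ (ψ : HTensor H K) ψ,
    fun x => ⟨fun _ => InnerProductSpace.isPositive_rankOne_self _, hu x⟩,
    fun y => ⟨fun _ => InnerProductSpace.isPositive_rankOne_self _, hv y⟩,
    isDensity_rankOne (by rwa [UniformSpace.Completion.norm_coe]), fun a b x y => ?_⟩
  convert! hasTrace_comp_rankOne _ (ψ : HTensor H K) ψ
  rw [opTensor_coe, UniformSpace.Completion.inner_coe, inner_mapL_rankOne_apply,
    ← inner_conj_symm ψ, Complex.conj_mul']
  norm_cast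

/-- The unit vector of the qubit space at the angle `θ` from the first basis vector in the real
plane. -/
def realQubit (θ : ℝ) : EuclideanSpace ℂ (Fin 2) :=
  !₂[(Real.cos θ : ℂ), (Real.sin θ : ℂ)]

theorem sum_rankOne_realQubit (θ : ℝ) :
    ∑ a : Fin 2, rankOne ℂ (realQubit (θ + a.val * (Real.pi / 2)))
      (realQubit (θ + a.val * (Real.pi / 2))) = 1 := by
  have h : (Real.cos θ : ℂ) ^ 2 + (Real.sin θ : ℂ) ^ 2 = 1 :=
    mod_cast Real.cos_sq_add_sin_sq θ
  simp only [Fin.sum_univ_two, Fin.val_zero, Fin.val_one, Nat.cast_zero, Nat.cast_one, zero_mul,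
    one_mul, add_zero, realQubit, Real.cos_add_pi_div_two, Real.sin_add_pi_div_two,
    Complex.ofReal_neg]
  ext v i
  fin_cases i <;>
    simp only [add_apply, InnerProductSpace.rankOne_apply, PiLp.inner_apply, RCLike.inner_apply,
      Fin.sum_univ_two, PiLp.add_apply, PiLp.smul_apply, smul_eq_mul, one_apply_eq_self, map_neg,
      Complex.conj_ofReal, Fin.zero_eta, Fin.mk_one, Matrix.cons_val_zero, Matrix.cons_val_one,
      Matrix.cons_val_fin_one]
  · linear_combination v 0 * h
  · linear_combination v 1 * h

/-- The two-qubit state `cos χ |00⟩ + sin χ |11⟩`. -/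
def schmidtState (χ : ℝ) : EuclideanSpace ℂ (Fin 2) ⊗[ℂ] EuclideanSpace ℂ (Fin 2) :=
  EuclideanSpace.single 0 (Real.cos χ : ℂ) ⊗ₜ EuclideanSpace.single 0 1 +
    EuclideanSpace.single 1 (Real.sin χ : ℂ) ⊗ₜ EuclideanSpace.single 1 1

theorem norm_schmidtState (χ : ℝ) : ‖schmidtState χ‖ = 1 := by
  have h : Real.cos χ * Real.cos χ + Real.sin χ * Real.sin χ = 1 := by
    rw [← sq, ← sq, Real.cos_sq_add_sin_sq]
  rw [norm_eq_sqrt_re_inner (𝕜 := ℂ), Real.sqrt_eq_one]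
  simp only [schmidtState, inner_add_left, inner_add_right, TensorProduct.inner_tmul,
    EuclideanSpace.inner_single_right]
  simpa [-Complex.ofReal_cos, -Complex.ofReal_sin] using h

theorem inner_realQubit_tmul_schmidtState (χ α β : ℝ) :
    ⟪realQubit α ⊗ₜ[ℂ] realQubit β, schmidtState χ⟫_ℂ =
      (Real.cos χ * (Real.cos α * Real.cos β) + Real.sin χ * (Real.sin α * Real.sin β) : ℝ) := by
  simp only [schmidtState, realQubit, inner_add_right, TensorProduct.inner_tmul,
    EuclideanSpace.inner_single_right, Matrix.cons_val_zero, Matrix.cons_val_one,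
    Matrix.cons_val_fin_one, Complex.conj_ofReal]
  push_cast
  ring

/-- The statistics of the state `cos χ |00⟩ + sin χ |11⟩` when Alice and Bob measure in the
computational basis rotated by the angles `α x` and `β y`. -/
def schmidtBehavior (χ : ℝ) (α β : Fin 2 → ℝ) : Behavior := fun a b x y =>
  (Real.cos χ * (Real.cos (α x + a.val * (Real.pi / 2)) * Real.cos (β y + b.val * (Real.pi / 2))) +
    Real.sin χ *
      (Real.sin (α x + a.val * (Real.pi / 2)) * Real.sin (β y + b.val * (Real.pi / 2)))) ^ 2

theorem isQuantum_schmidtBehavior (χ : ℝ) (α β : Fin 2 → ℝ) :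
    IsQuantum (schmidtBehavior χ α β) := by
  convert! isQuantum_of_sum_rankOne_eq_one (fun x => sum_rankOne_realQubit (α x))
    (fun y => sum_rankOne_realQubit (β y)) (norm_schmidtState χ) using 5
  rw [inner_realQubit_tmul_schmidtState, Complex.norm_real, Real.norm_eq_abs, sq_abs,
    schmidtBehavior]

theorem correlator_schmidtBehavior (χ : ℝ) (α β : Fin 2 → ℝ) (x y : Fin 2) :
    correlator (schmidtBehavior χ α β) x y =
      Real.cos (2 * α x) * Real.cos (2 * β y) +
        Real.sin (2 * χ) * (Real.sin (2 * α x) * Real.sin (2 * β y)) := by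
  simp only [correlator, schmidtBehavior, Fin.sum_univ_two, Fin.val_zero, Fin.val_one,
    Nat.cast_zero, Nat.cast_one, zero_mul, one_mul, add_zero, Real.cos_add_pi_div_two,
    Real.sin_add_pi_div_two, Real.cos_two_mul', Real.sin_two_mul]
  linear_combination (Real.cos (α x) ^ 2 - Real.sin (α x) ^ 2) *
    (Real.cos (β y) ^ 2 - Real.sin (β y) ^ 2) * Real.cos_sq_add_sin_sq χ

theorem marginal_schmidtBehavior (χ : ℝ) (α β : Fin 2 → ℝ) (a x : Fin 2) :
    marginal (schmidtBehavior χ α β) a x =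
      (Real.cos χ * Real.cos (α x + a.val * (Real.pi / 2))) ^ 2 +
        (Real.sin χ * Real.sin (α x + a.val * (Real.pi / 2))) ^ 2 := by
  simp only [marginal, schmidtBehavior, Fin.sum_univ_two, Fin.val_zero, Fin.val_one,
    Nat.cast_zero, Nat.cast_one, zero_mul, one_mul, add_zero, Real.cos_add_pi_div_two,
    Real.sin_add_pi_div_two]
  linear_combination ((Real.cos χ * Real.cos (α x + a.val * (Real.pi / 2))) ^ 2 +
    (Real.sin χ * Real.sin (α x + a.val * (Real.pi / 2))) ^ 2) * Real.cos_sq_add_sin_sq (β 0)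

/-- The behavior attaining the optimum: the guessed measurement `xs` of Alice is in the Schmidt
basis of the state, her other one is unbiased to it. -/
def optimalBehavior (χ μ : ℝ) (xs : Fin 2) : Behavior :=
  schmidtBehavior χ (fun x => if x = xs then 0 else Real.pi / 4)
    ![μ / 2, (xs.val * Real.pi - μ) / 2]

theorem score_optimalBehavior (χ μ r : ℝ) (xs : Fin 2) :
    score (biasedInputs r xs) (optimalBehavior χ μ xs) =
      4 * (r * Real.cos μ + (1 - r) * Real.sin (2 * χ) * Real.sin μ) := by
  have hne : 1 - xs ≠ xs := by fin_cases xs <;> decide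
  have hα : 2 * (Real.pi / 4) = Real.pi / 2 := by ring
  have h₀ : correlator (optimalBehavior χ μ xs) xs 0 = Real.cos μ := by
    simp [optimalBehavior, correlator_schmidtBehavior, mul_div_cancel₀]
  have h₁ : correlator (optimalBehavior χ μ xs) xs 1 = (-1) ^ xs.val * Real.cos μ := by
    simp [optimalBehavior, correlator_schmidtBehavior, mul_div_cancel₀, Real.cos_nat_mul_pi_sub]
  have h₂ : correlator (optimalBehavior χ μ xs) (1 - xs) 0 = Real.sin (2 * χ) * Real.sin μ := by
    simp [optimalBehavior, correlator_schmidtBehavior, mul_div_cancel₀, hne, hα]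
  have h₃ : correlator (optimalBehavior χ μ xs) (1 - xs) 1 =
      -((-1) ^ xs.val * (Real.sin (2 * χ) * Real.sin μ)) := by
    simp [optimalBehavior, correlator_schmidtBehavior, mul_div_cancel₀, hne, hα,
      Real.sin_nat_mul_pi_sub, mul_left_comm]
  have hsq : (-1 : ℝ) ^ xs.val * (-1) ^ xs.val = 1 := by rw [← mul_pow]; simp
  rw [score_biasedInputs, h₀, h₁, h₂, h₃]
  linear_combination 2 * (r * Real.cos μ + (1 - r) * Real.sin (2 * χ) * Real.sin μ) * hsq

theorem isQuantum_optimalBehavior (χ μ : ℝ) (xs : Fin 2) : IsQuantum (optimalBehavior χ μ xs) :=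
  isQuantum_schmidtBehavior _ _ _

theorem max_marginal_optimalBehavior (χ μ : ℝ) (xs : Fin 2) :
    max (marginal (optimalBehavior χ μ xs) 0 xs) (marginal (optimalBehavior χ μ xs) 1 xs) =
      1 / 2 * (1 + |Real.cos (2 * χ)|) := by
  rw [max_eq_half_of_add_eq_one ((isQuantum_optimalBehavior χ μ xs).marginal_add xs)]
  simp [optimalBehavior, marginal_schmidtBehavior, Real.cos_two_mul']

theorem mem_guessingValues_of_isQuantum {V : Behavior → ℝ} {P : Behavior} (hP : IsQuantum P)
    (xs : Fin 2) : max (marginal P 0 xs) (marginal P 1 xs) ∈ guessingValues V xs (V P) := by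
  refine ⟨Unit, fun _ => 1, fun _ => P, fun _ => zero_le_one, ?_, fun _ => hP, ?_, ?_⟩
  · exact hasSum_unique _
  · congr 1
    funext a b x y
    simp [average]
  · simp

theorem exists_mul_cos_add_mul_sin_eq_sqrt (a b : ℝ) :
    ∃ μ : ℝ, a * Real.cos μ + b * Real.sin μ = √(a ^ 2 + b ^ 2) := by
  let z : ℂ := ⟨a, b⟩
  refine ⟨z.arg, ?_⟩
  have ha : ‖z‖ * Real.cos z.arg = a := Complex.norm_mul_cos_arg z
  have hb : ‖z‖ * Real.sin z.arg = b := Complex.norm_mul_sin_arg z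
  have hz : ‖z‖ = √(a ^ 2 + b ^ 2) := Complex.norm_eq_sqrt_sq_add_sq z
  linear_combination (-Real.cos z.arg) * ha - Real.sin z.arg * hb + hz +
    ‖z‖ * Real.cos_sq_add_sin_sq z.arg

theorem guessFormula_four_mul_sqrt {r : ℝ} (hr : r ≠ 1) (θ : ℝ) :
    guessFormula r (4 * √(r ^ 2 + ((1 - r) * Real.sin θ) ^ 2)) = 1 / 2 * (1 + |Real.cos θ|) := by
  have hr' : 1 - r ≠ 0 := sub_ne_zero.2 hr.symm
  have hdiv : 1 / (1 - r) ^ 2 * ((1 - r) * Real.sin θ) ^ 2 = Real.sin θ ^ 2 := by field_simp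
  rw [guessFormula, mul_div_cancel_left₀ _ four_ne_zero, Real.sq_sqrt (by positivity),
    add_sub_cancel_left, hdiv, Real.abs_cos_eq_sqrt_one_sub_sin_sq]

theorem exists_eq_four_mul_sqrt {r S : ℝ} (hr₀ : 0 ≤ r)
    (hS : S ∈ Set.Icc (4 * r) (4 * √(r ^ 2 + (1 - r) ^ 2))) :
    ∃ θ : ℝ, 4 * √(r ^ 2 + ((1 - r) * Real.sin θ) ^ 2) = S := by
  have hcont : Continuous fun θ => 4 * √(r ^ 2 + ((1 - r) * Real.sin θ) ^ 2) := by fun_prop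
  have hS' : S ∈ Set.Icc (4 * √(r ^ 2 + ((1 - r) * Real.sin 0) ^ 2))
      (4 * √(r ^ 2 + ((1 - r) * Real.sin (Real.pi / 2)) ^ 2)) := by
    simpa [Real.sqrt_sq hr₀] using hS
  exact mem_range_of_exists_le_of_exists_ge hcont ⟨0, hS'.1⟩ ⟨Real.pi / 2, hS'.2⟩

theorem guessFormula_mem_guessingValues {xs : Fin 2} {r S : ℝ} (hr₀ : 0 ≤ r) (hr₁ : r < 1)
    (hS : S ∈ Set.Icc (4 * r) (4 * √(r ^ 2 + (1 - r) ^ 2))) :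
    guessFormula r S ∈ guessingValues (score (biasedInputs r xs)) xs S := by
  obtain ⟨θ, rfl⟩ := exists_eq_four_mul_sqrt hr₀ hS
  obtain ⟨μ, hμ⟩ := exists_mul_cos_add_mul_sin_eq_sqrt r ((1 - r) * Real.sin θ)
  have hθ : 2 * (θ / 2) = θ := mul_div_cancel₀ _ two_ne_zero
  have hmem := mem_guessingValues_of_isQuantum (V := score (biasedInputs r xs))
    (isQuantum_optimalBehavior (θ / 2) μ xs) xs
  rwa [max_marginal_optimalBehavior, score_optimalBehavior, hθ, hμ,
    ← guessFormula_four_mul_sqrt hr₁.ne] at hmem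

end Attainment

section Unbiased

theorem score_biasedInputs_half (xs : Fin 2) (P : Behavior) :
    score (biasedInputs (1 / 2) xs) P = chsh P := by
  have h (x y : Fin 2) : biasedInputs (1 / 2) xs x y = 1 / 4 := by
    rw [biasedInputs]
    split_ifs <;> norm_num
  simp only [score, chsh, h, Fin.sum_univ_two]
  ring

theorem guessFormula_half (S : ℝ) : guessFormula (1 / 2) S = 1 / 2 * (1 + √(2 - (S / 2) ^ 2)) := by
  rw [guessFormula]
  congr 3
  ring

end Unbiased

end BiasedCHSH

end

theorem mainTheorem3 (xs : Fin 2) :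
    (∀ r : ℝ, 1 / 2 ≤ r → r < 1 →
      ∀ S ∈ Set.Icc (4 * r) (4 * √(r ^ 2 + (1 - r) ^ 2)),
        IsGreatest
          (BiasedCHSH.guessingValues
            (BiasedCHSH.score (BiasedCHSH.biasedInputs r xs)) xs S)
          (BiasedCHSH.guessFormula r S)) ∧
    (∀ P : BiasedCHSH.Behavior,
      BiasedCHSH.score (BiasedCHSH.biasedInputs (1 / 2) xs) P = BiasedCHSH.chsh P) ∧
    (∀ S : ℝ, BiasedCHSH.guessFormula (1 / 2) S = 1 / 2 * (1 + √(2 - (S / 2) ^ 2))) :=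
  ⟨fun r hr hr₁ S hS =>
      ⟨BiasedCHSH.guessFormula_mem_guessingValues (by linarith) hr₁ hS,
        fun _ hg => BiasedCHSH.guessingValues_le_guessFormula hr hr₁ hg⟩,
    BiasedCHSH.score_biasedInputs_half xs, BiasedCHSH.guessFormula_half⟩
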